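/- Let $\mathcal{L}_2$ be the space of square-integrable signals $[0,\infty)\to\mathbb{R}^n$ with $\langle u,y\rangle=\int_0^\infty u(t)^\top y(t)\,dt$ and $\|u\|=\sqrt{\langle u,u\rangle}$, and let $\mathcal{L}_{2e}$ be the space of signals that are square-integrable on every $[0,T]$. A system is a map $H:\mathcal{L}_2\to\mathcal{L}_2$; it is bounded if there is $c$ with $\|H(u)\|\le c\|u\|$ for all $u\in\mathcal{L}_2$. A causal system extends to $\mathcal{L}_{2e}$ by letting the output on $[0,T]$ be that of the input truncated to $[0,T]$. A bounded system $H$ is *input strictly passive* if there is $\varepsilon>0$ such that $\langle u,H(u)\rangle\ge\varepsilon\|u\|^2$ for all $u\in\mathcal{L}_2$, and *passive* if $\langle u,H(u)\rangle\ge 0$ for all $u\in\mathcal{L}_2$. The negative feedback interconnection of causal systems $H_1,H_2$ is given by $u_1=w-y_2$, $u_2=y_1$, $y_1=H_1(u_1)$, $y_2=H_2(u_2)$. It is *well-posed* if the map $u_1\mapsto w$ has a causal inverse on $\mathcal{L}_{2e}$, and *finite-gain stable* if it is well-posed, every $w\in\mathcal{L}_2$ is mapped to some $u_1\in\mathcal{L}_2$,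 and there is $\gamma>0$ with $\|u_1\|\le\gamma\|w\|$ for all $w\in\mathcal{L}_2$. For $u,y\in\mathcal{L}_2$ extended by zero to negative times, let $\hat u(t)=\frac1\pi\,\mathrm{p.v.}\!\int_{-\infty}^{\infty}\frac{u(s)}{t-s}\,ds$ be the Hilbert transform and $[u,y]=\int_{-\infty}^\infty \hat u(t)^\top y(t)\,dt$. Put $\theta(u,y)=\arccos\frac{\langle u,y\rangle}{\|u\|\|y\|}$, and let $\varphi(u,y)=\operatorname{sgn}([u,y])\,\theta(u,y)$ if $[u,y]\ne0$, while $\varphi(u,y)$ takes both values $\pm\theta(u,y)$ if $[u,y]=0$. The signed scaled graph of $H$ is $$\mathrm{SSG}(H)=\Big\{\tfrac{\|y\|}{\|u\|}e^{j\varphi(u,y)} : u\in\mathcal{L}_2,\ u\neq0,\ y=H(u)\Big\}\subset\mathbb{C}$$ (the point $0$ when $y=0$), and its inverse is $$\mathrm{SSG}^\dagger(H)=\Big\{\tfrac{\|u\|}{\|y\|}e^{j\varphi(y,u)} : u\in\mathcal{L}_2,\ y=H(u)\neq0\Big\}.$$ Let $\mathcal{W}$ be the set of all $w\in\mathcal{L}_2$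 for which there are $\tau\in(0,1]$ and $u_1\in\mathcal{L}_2$, $u_2=H_1(u_1)$, $y_2=H_2(u_2)$ with $w=u_1+\tau y_2$, $\langle u_1,u_2\rangle+\langle u_2,\tau y_2\rangle=0$, $\|u_1\|=\|\tau y_2\|$ and $[u_1,u_2]\,[u_2,\tau y_2]<0$. **Corollary (passivity theorem).** Let $H_1,H_2:\mathcal{L}_2\to\mathcal{L}_2$ be causal systems whose negative feedback interconnection is well-posed. If $H_1$ is input strictly passive and $H_2$ is passive, then the interconnection is finite-gain stable. Moreover: 1. there is $\varepsilon>0$ with $\mathrm{SSG}(H_1)\subset\{z:\operatorname{Re}z\ge\varepsilon\}$, and $\mathrm{SSG}^\dagger(-\tau H_2)\subset\{z:\operatorname{Re}z\le0\}$ for all $\tau\in(0,1]$; 2. there is $r>0$ such that $\inf\{|a-b| : a\in\mathrm{SSG}^\dagger(H_1),\ b\in\mathrm{SSG}(-\tau H_2)\}\ge r$ for all $\tau\in(0,1]$ (with $\inf\emptyset=\infty$); 3. $\mathcal{W}=\emptyset$. -/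

import Mathlib

open MeasureTheory Set Filter Topology

noncomputable section

namespace PassivityFeedback

/-- Lebesgue measure on the time axis `[0, ∞)`. -/
def timeMeasure : Measure ℝ := volume.restrict (Ici 0)

/-- Measurable signals `[0, ∞) → ℝⁿ`, up to almost everywhere equality. -/
abbrev Signal (n : ℕ) := ℝ →ₘ[timeMeasure] EuclideanSpace ℝ (Fin n)

/-- The space of square-integrable signals on `[0, ∞)`, with inner product
`⟨u, y⟩ = ∫₀^∞ u(t)ᵀ y(t) dt`. -/
abbrev L2 (n : ℕ) := Lp (EuclideanSpace ℝ (Fin n)) 2 timeMeasure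

/-- Truncation of a signal: equal to `f` on `[0, T]` and to `0` afterwards. -/
def trunc {n : ℕ} (T : ℝ) (f : Signal n) : Signal n :=
  AEEqFun.mk ((Iic T).indicator f) (f.aestronglyMeasurable.indicator measurableSet_Iic)

theorem coeFn_trunc {n : ℕ} (T : ℝ) (f : Signal n) :
    (trunc T f : ℝ → EuclideanSpace ℝ (Fin n)) =ᵐ[timeMeasure] (Iic T).indicator f :=
  AEEqFun.coeFn_mk _ _

theorem trunc_zero {n : ℕ} (T : ℝ) : trunc T (0 : Signal n) = 0 := by
  apply AEEqFun.ext
  filter_upwards [coeFn_trunc T (0 : Signal n),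
    AEEqFun.coeFn_zero (α := ℝ) (μ := timeMeasure) (β := EuclideanSpace ℝ (Fin n))] with t h1 h2
  rw [h1, h2]
  by_cases ht : t ≤ T <;> simp [indicator, h2, ht]

theorem trunc_add {n : ℕ} (T : ℝ) (f g : Signal n) :
    trunc T (f + g) = trunc T f + trunc T g := by
  apply AEEqFun.ext
  filter_upwards [coeFn_trunc T (f + g), coeFn_trunc T f, coeFn_trunc T g,
    AEEqFun.coeFn_add f g, AEEqFun.coeFn_add (trunc T f) (trunc T g)] with t h1 h2 h3 h4 h5
  rw [h1, h5, Pi.add_apply, h2, h3]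
  by_cases ht : t ≤ T <;> simp [indicator, h4, ht]

theorem trunc_neg {n : ℕ} (T : ℝ) (f : Signal n) : trunc T (-f) = -trunc T f := by
  apply AEEqFun.ext
  filter_upwards [coeFn_trunc T (-f), coeFn_trunc T f,
    AEEqFun.coeFn_neg f, AEEqFun.coeFn_neg (trunc T f)] with t h1 h2 h3 h4
  rw [h1, h4, Pi.neg_apply, h2]
  by_cases ht : t ≤ T <;> simp [indicator, h3, ht]

/-- The extended space `L₂ₑ`: signals that are square-integrable over every interval `[0, T]`. -/
def L2e (n : ℕ) : AddSubgroup (Signal n) where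
  carrier := {f | ∀ T : ℝ, trunc T f ∈ L2 n}
  zero_mem' := fun T => by rw [trunc_zero]; exact zero_mem _
  add_mem' := fun {f g} hf hg T => by rw [trunc_add]; exact add_mem (hf T) (hg T)
  neg_mem' := fun {f} hf T => by rw [trunc_neg]; exact neg_mem (hf T)

/-- Truncation of a signal in `L₂ₑ`, as an element of `L₂`. -/
def truncL2 {n : ℕ} (T : ℝ) (u : L2e n) : L2 n := ⟨trunc T u, u.2 T⟩

/-- A map between signal spaces (such as `L₂` or `L₂ₑ`) is causal if the output on `[0, T]`
depends only on the input on `[0, T]`. -/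
def IsCausal {n : ℕ} {X Y : AddSubgroup (Signal n)} (F : X → Y) : Prop :=
  ∀ (T : ℝ) (u v : X), trunc T (u : Signal n) = trunc T (v : Signal n) →
    trunc T (F u : Signal n) = trunc T (F v : Signal n)

/-- A system `H : L₂ → L₂` is finite-gain stable (bounded). In particular `H 0 = 0`. -/
def IsBoundedSystem {n : ℕ} (H : L2 n → L2 n) : Prop :=
  ∃ r : ℝ, ∀ u, ‖H u‖ ≤ r * ‖u‖

/-- Input strict passivity, with a constant `ε` that is uniform in the input. -/
def IsInputStrictlyPassive {n : ℕ} (H : L2 n → L2 n) : Prop :=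
  IsBoundedSystem H ∧ ∃ ε : ℝ, 0 < ε ∧ ∀ u : L2 n, ε * ‖u‖ ^ 2 ≤ inner ℝ u (H u)

/-- Passivity. -/
def IsPassive {n : ℕ} (H : L2 n → L2 n) : Prop :=
  IsBoundedSystem H ∧ ∀ u : L2 n, 0 ≤ inner ℝ u (H u)

/-- The graph of the extension to `L₂ₑ` of a causal system `H : L₂ → L₂`: the output `y` for the
input `u` agrees on every `[0, T]` with the output of `H` for the truncated input. -/
def ExtendedOutput {n : ℕ} (H : L2 n → L2 n) (u y : L2e n) : Prop :=
  ∀ T : ℝ, trunc T (y : Signal n) = trunc T (H (truncL2 T u) : Signal n)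

/-- The graph of the map `u₁ ↦ w` on `L₂ₑ` for the negative feedback interconnection
`u₁ = w - y₂`, `u₂ = y₁`, `y₁ = H₁ u₁`, `y₂ = H₂ u₂`. -/
def FeedbackLoop {n : ℕ} (H₁ H₂ : L2 n → L2 n) (u₁ w : L2e n) : Prop :=
  ∃ u₂ y₁ y₂ : L2e n,
    ExtendedOutput H₁ u₁ y₁ ∧ ExtendedOutput H₂ u₂ y₂ ∧ u₂ = y₁ ∧ u₁ = w - y₂

/-- Well-posedness: the map `u₁ ↦ w` has a causal (two-sided) inverse `G` on `L₂ₑ`. -/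
def WellPosed {n : ℕ} (H₁ H₂ : L2 n → L2 n) : Prop :=
  ∃ G : L2e n → L2e n, IsCausal G ∧ ∀ u₁ w : L2e n, FeedbackLoop H₁ H₂ u₁ w ↔ u₁ = G w

/-- Feedback stability: well-posedness, and inputs `w ∈ L₂` are mapped to `u₁ ∈ L₂`. -/
def FeedbackStable {n : ℕ} (H₁ H₂ : L2 n → L2 n) : Prop :=
  WellPosed H₁ H₂ ∧ ∀ u₁ w : L2e n, FeedbackLoop H₁ H₂ u₁ w →
    (w : Signal n) ∈ L2 n → (u₁ : Signal n) ∈ L2 n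

/-- Finite-gain feedback stability: stability and `‖u₁‖ ≤ γ ‖w‖` for all `w ∈ L₂`. -/
def FeedbackFiniteGainStable {n : ℕ} (H₁ H₂ : L2 n → L2 n) : Prop :=
  FeedbackStable H₁ H₂ ∧ ∃ γ : ℝ, 0 < γ ∧ ∀ u₁ w : L2e n, FeedbackLoop H₁ H₂ u₁ w →
    ∀ (hw : (w : Signal n) ∈ L2 n) (hu : (u₁ : Signal n) ∈ L2 n),
      ‖(⟨u₁, hu⟩ : L2 n)‖ ≤ γ * ‖(⟨w, hw⟩ : L2 n)‖

/-- The embedding of `L₂` into the square-integrable functions on the whole line, by zero on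
negative times. -/
def embed {n : ℕ} (u : L2 n) : ℝ → EuclideanSpace ℝ (Fin n) :=
  (Ici (0 : ℝ)).indicator u

/-- The Hilbert transform `(1/π) p.v. ∫ f(s) / (t - s) ds`, as a Cauchy principal value. -/
def hilbertTransform {n : ℕ} (f : ℝ → EuclideanSpace ℝ (Fin n)) (t : ℝ) :
    EuclideanSpace ℝ (Fin n) :=
  limUnder (𝓝[>] (0 : ℝ)) fun δ : ℝ =>
    (1 / Real.pi) • ∫ s in {s : ℝ | δ < |t - s|}, (1 / (t - s)) • f s

/-- The pairing over the whole line of the Hilbert transform of `u` with `y`. -/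
def hilbertPairing {n : ℕ} (u y : L2 n) : ℝ :=
  ∫ t : ℝ, inner ℝ (hilbertTransform (embed u) t) (embed y t)

/-- The values of the signed phase: `sgn ⟨û, y⟩ · θ` if `⟨û, y⟩ ≠ 0`, and both `±θ` otherwise,
where `θ = arccos (⟨u, y⟩ / (‖u‖ ‖y‖))`. -/
def signedPhases {n : ℕ} (u y : L2 n) : Set ℝ :=
  {φ | (hilbertPairing u y ≠ 0 ∧
          φ = Real.sign (hilbertPairing u y) * InnerProductGeometry.angle u y) ∨
       (hilbertPairing u y = 0 ∧
          (φ = InnerProductGeometry.angle u y ∨ φ = -InnerProductGeometry.angle u y))}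

/-- The complex numbers `ρ(u, y) exp(j φ(u, y))` with `ρ(u, y) = ‖y‖ / ‖u‖`, for `u ≠ 0`. -/
def gainPhasePoints {n : ℕ} (u y : L2 n) : Set ℂ :=
  {z | ∃ φ ∈ signedPhases u y, z = ((‖y‖ / ‖u‖ : ℝ) : ℂ) * Complex.exp (Complex.I * (φ : ℂ))}

/-- The signed scaled graph (its finite points: zero inputs have gain `∞`). -/
def SSG {n : ℕ} (H : L2 n → L2 n) : Set ℂ :=
  {z | ∃ u : L2 n, u ≠ 0 ∧ z ∈ gainPhasePoints u (H u)}

/-- The inverse signed scaled graph: input and output are swapped. -/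
def SSGinv {n : ℕ} (H : L2 n → L2 n) : Set ℂ :=
  {z | ∃ u : L2 n, H u ≠ 0 ∧ z ∈ gainPhasePoints (H u) u}

/-- The system `-τ H`. -/
def negScale {n : ℕ} (τ : ℝ) (H : L2 n → L2 n) : L2 n → L2 n := fun u => (-τ) • H u

/-- The distance `inf |a - b|` between two sets (`∞` if one of them is empty). -/
def setDist (A B : Set ℂ) : ENNReal := ⨅ a ∈ A, ⨅ b ∈ B, edist a b

/-- The set `𝒲` of exceptional inputs `w`. -/
def exceptionalInputs {n : ℕ} (H₁ H₂ : L2 n → L2 n) : Set (L2 n) :=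
  {w | ∃ τ ∈ Ioc (0 : ℝ) 1, ∃ u₁ u₂ y₂ : L2 n, u₂ = H₁ u₁ ∧ y₂ = H₂ u₂ ∧ w = u₁ + τ • y₂ ∧
    inner ℝ u₁ u₂ + inner ℝ u₂ (τ • y₂) = (0 : ℝ) ∧ ‖u₁‖ - ‖τ • y₂‖ = 0 ∧
    hilbertPairing u₁ u₂ * hilbertPairing u₂ (τ • y₂) < 0}

end PassivityFeedback

end

open MeasureTheory Set Filter Topology

namespace PassivityFeedback

variable {n : ℕ}

/-! ### Truncations -/

/-! Stability is the classical energy argument on `[0, T]`. Pairing `w = u₁ + y₂` with `y₁ = u₂`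
gives `⟨w, y₁⟩ = ⟨u₁, y₁⟩ + ⟨y₁, y₂⟩ ≥ ε‖u₁‖²`, while Cauchy–Schwarz gives `⟨w, y₁⟩ ≤ c‖w‖‖u₁‖`.
Hence `‖u₁‖ ≤ (c/ε)‖w‖` for the truncations (`FeedbackLoop.norm_truncL2_le`), uniformly in `T`, and
`exists_mem_L2_norm_le` lets `T → ∞`. The graph claims follow from `re_of_mem_gainPhasePoints`: the
real part of a point is `⟨u, y⟩ / ‖u‖²`, so passivity places the graphs in half-planes. An
exceptional input would force `u₁ = 0`, where the Hilbert pairings vanish. -/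

theorem norm_truncL2_le_of_trunc_eq (T : ℝ) (u : L2e n) (v : L2 n)
    (h : trunc T (u : Signal n) = trunc T (v : Signal n)) : ‖truncL2 T u‖ ≤ ‖v‖ := by
  apply Lp.norm_le_norm_of_ae_le
  filter_upwards [coeFn_trunc T (v : Signal n)] with t ht
  change ‖(trunc T (u : Signal n) : ℝ → EuclideanSpace ℝ (Fin n)) t‖ ≤ _
  rw [h, ht]
  exact norm_indicator_le_norm_self _ _

/-- The truncated factor kills the integrand after `T`, so only the values on `[0, T]` count. -/
theorem inner_truncL2_congr (T : ℝ) (u : L2e n) (a b : L2 n)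
    (h : trunc T (a : Signal n) = trunc T (b : Signal n)) :
    inner ℝ (truncL2 T u) a = inner ℝ (truncL2 T u) b := by
  rw [L2.inner_def, L2.inner_def]
  apply integral_congr_ae
  have hb := coeFn_trunc T (b : Signal n)
  rw [← h] at hb
  filter_upwards [coeFn_trunc T (u : Signal n), coeFn_trunc T (a : Signal n), hb] with t hu ha hb
  change inner ℝ ((trunc T (u : Signal n) : ℝ → EuclideanSpace ℝ (Fin n)) t) _ =
    inner ℝ ((trunc T (u : Signal n) : ℝ → EuclideanSpace ℝ (Fin n)) t) _
  rw [hu]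
  by_cases ht : t ∈ Iic T
  · rw [ha, indicator_of_mem ht, indicator_of_mem ht] at hb
    rw [hb]
  · simp [indicator_of_notMem ht]

theorem trunc_trunc (T : ℝ) (f : Signal n) : trunc T (trunc T f) = trunc T f := by
  apply AEEqFun.ext
  filter_upwards [coeFn_trunc T (trunc T f), coeFn_trunc T f] with t h1 h2
  rw [h1]
  by_cases ht : t ∈ Iic T
  · rw [indicator_of_mem ht]
  · rw [h2, indicator_of_notMem ht, indicator_of_notMem ht]

theorem truncL2_add (T : ℝ) (u v : L2e n) :
    truncL2 T (u + v) = truncL2 T u + truncL2 T v :=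
  Subtype.ext (trunc_add T (u : Signal n) (v : Signal n))

/-- A signal whose truncations are bounded in `L₂` is in `L₂`, with the same bound. -/
theorem exists_mem_L2_norm_le (u : L2e n) {C : ℝ} (hC : ∀ T : ℝ, ‖truncL2 T u‖ ≤ C) :
    ∃ h : (u : Signal n) ∈ L2 n, ‖(⟨u, h⟩ : L2 n)‖ ≤ C := by
  have hC0 : 0 ≤ C := (norm_nonneg _).trans (hC 0)
  have hle : eLpNorm (u : Signal n) 2 timeMeasure ≤ ENNReal.ofReal C := by
    have hlim : ∀ᵐ t ∂timeMeasure, Tendsto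
        (fun k : ℕ => (trunc (k : ℝ) (u : Signal n) : ℝ → EuclideanSpace ℝ (Fin n)) t) atTop
        (𝓝 ((u : Signal n) t)) := by
      filter_upwards [ae_all_iff.2 fun k : ℕ => coeFn_trunc (k : ℝ) (u : Signal n)] with t ht
      apply tendsto_const_nhds.congr'
      filter_upwards [eventually_ge_atTop ⌈t⌉₊] with k hk
      rw [ht k, indicator_of_mem]
      exact Nat.ceil_le.1 hk
    -- Fatou's lemma along integer horizons.
    refine (Lp.eLpNorm_lim_le_liminf_eLpNorm
      (fun k => (trunc (k : ℝ) (u : Signal n)).aestronglyMeasurable) _ hlim).trans ?_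
    refine liminf_le_of_le (by isBoundedDefault) fun b hb => ?_
    obtain ⟨k, hk⟩ := hb.exists
    refine hk.trans ?_
    have := hC k
    rw [Lp.norm_def] at this
    exact (ENNReal.le_ofReal_iff_toReal_le (Lp.eLpNorm_ne_top (truncL2 (k : ℝ) u)) hC0).2 this
  refine ⟨Lp.mem_Lp_iff_eLpNorm_lt_top.2 (hle.trans_lt ENNReal.ofReal_lt_top), ?_⟩
  rw [Lp.norm_def]
  exact ENNReal.toReal_le_of_le_ofReal hC0 hle

/-! ### Passive systems -/

theorem IsBoundedSystem.exists_pos {H : L2 n → L2 n} (h : IsBoundedSystem H) :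
    ∃ c : ℝ, 0 < c ∧ ∀ u, ‖H u‖ ≤ c * ‖u‖ := by
  obtain ⟨r, hr⟩ := h
  -- Positivity of the gain keeps the later constants `c / ε` and `ε / c ^ 2` positive.
  exact ⟨max r 1, lt_max_of_lt_right one_pos, fun u => (hr u).trans
    (mul_le_mul_of_nonneg_right (le_max_left _ _) (norm_nonneg u))⟩

theorem IsBoundedSystem.map_zero {H : L2 n → L2 n} (h : IsBoundedSystem H) : H 0 = 0 := by
  obtain ⟨r, hr⟩ := h
  simpa using hr 0

theorem ExtendedOutput.inner_truncL2 {H : L2 n → L2 n} {u y : L2e n}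
    (h : ExtendedOutput H u y) (T : ℝ) :
    inner ℝ (truncL2 T u) (truncL2 T y) = inner ℝ (truncL2 T u) (H (truncL2 T u)) :=
  inner_truncL2_congr T u _ _ ((trunc_trunc T _).trans (h T))

/-- The passivity estimate for the feedback loop, on a finite time horizon. -/
theorem FeedbackLoop.norm_truncL2_le {H₁ H₂ : L2 n → L2 n} {u₁ w : L2e n}
    (hl : FeedbackLoop H₁ H₂ u₁ w) {ε c : ℝ} (hε : 0 < ε)
    (hp₁ : ∀ u : L2 n, ε * ‖u‖ ^ 2 ≤ inner ℝ u (H₁ u)) (hb₁ : ∀ u, ‖H₁ u‖ ≤ c * ‖u‖)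
    (hp₂ : ∀ u : L2 n, 0 ≤ inner ℝ u (H₂ u)) (T : ℝ) :
    ‖truncL2 T u₁‖ ≤ c / ε * ‖truncL2 T w‖ := by
  obtain ⟨y₁, _, y₂, h₁, h₂, rfl, hw⟩ := hl
  have hw' : truncL2 T w = truncL2 T u₁ + truncL2 T y₂ := by
    rw [← truncL2_add, hw, sub_add_cancel]
  have e₁ := (hp₁ (truncL2 T u₁)).trans_eq (h₁.inner_truncL2 T).symm
  have e₂ := (hp₂ (truncL2 T y₁)).trans_eq (h₂.inner_truncL2 T).symm
  have e₃ : ‖truncL2 T y₁‖ ≤ c * ‖truncL2 T u₁‖ :=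
    (norm_truncL2_le_of_trunc_eq T y₁ _ (h₁ T)).trans (hb₁ _)
  have e₄ : inner ℝ (truncL2 T w) (truncL2 T y₁) =
      inner ℝ (truncL2 T u₁) (truncL2 T y₁) + inner ℝ (truncL2 T y₁) (truncL2 T y₂) := by
    rw [hw', inner_add_left, real_inner_comm (truncL2 T y₁) (truncL2 T y₂)]
  have e₅ := real_inner_le_norm (truncL2 T w) (truncL2 T y₁)
  have e₆ : ε * ‖truncL2 T u₁‖ ^ 2 ≤ ‖truncL2 T w‖ * (c * ‖truncL2 T u₁‖) := by
    have := mul_le_mul_of_nonneg_left e₃ (norm_nonneg (truncL2 T w))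
    linarith
  rcases (norm_nonneg (truncL2 T u₁)).eq_or_lt with h0 | hpos
  -- Here `‖u₁‖` cannot be cancelled. The sign of `c * ‖w‖` comes from the gain bound itself.
  · have hc : 0 ≤ c * ‖truncL2 T w‖ := (norm_nonneg _).trans (hb₁ (truncL2 T w))
    rw [← h0, div_mul_eq_mul_div]
    positivity
  · rw [div_mul_eq_mul_div, le_div_iff₀ hε]
    nlinarith

theorem feedbackFiniteGainStable_of_passive {H₁ H₂ : L2 n → L2 n} (hwp : WellPosed H₁ H₂)
    (h₁ : IsInputStrictlyPassive H₁) (h₂ : IsPassive H₂) : FeedbackFiniteGainStable H₁ H₂ := by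
  obtain ⟨hb₁, ε, hε, hp₁⟩ := h₁
  obtain ⟨c, hc, hb₁⟩ := hb₁.exists_pos
  have key : ∀ u₁ w : L2e n, FeedbackLoop H₁ H₂ u₁ w → ∀ hw : (w : Signal n) ∈ L2 n,
      ∃ h : (u₁ : Signal n) ∈ L2 n, ‖(⟨u₁, h⟩ : L2 n)‖ ≤ c / ε * ‖(⟨w, hw⟩ : L2 n)‖ := by
    intro u₁ w hl hw
    refine exists_mem_L2_norm_le u₁ fun T => (hl.norm_truncL2_le hε hp₁ hb₁ h₂.2 T).trans ?_
    exact mul_le_mul_of_nonneg_left (norm_truncL2_le_of_trunc_eq T w ⟨w, hw⟩ rfl)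
      (div_pos hc hε).le
  exact ⟨⟨hwp, fun u₁ w hl hw => (key u₁ w hl hw).1⟩, c / ε, div_pos hc hε,
    fun u₁ w hl hw _ => (key u₁ w hl hw).2⟩

/-! ### Signed scaled graphs -/

/-- Cosine is even, so the sign of the phase, and with it the Hilbert transform, does not affect the
real part. -/
theorem re_of_mem_gainPhasePoints {u y : L2 n} {z : ℂ} (hz : z ∈ gainPhasePoints u y) :
    z.re = inner ℝ u y / ‖u‖ ^ 2 := by
  obtain ⟨φ, hφ, rfl⟩ := hz
  have hcos : Real.cos φ = Real.cos (InnerProductGeometry.angle u y) := by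
    rcases hφ with ⟨h0, rfl⟩ | ⟨-, rfl | rfl⟩
    · rcases Real.sign_apply_eq_of_ne_zero _ h0 with h | h <;> simp [h]
    · rfl
    · exact Real.cos_neg _
  rw [Complex.re_ofReal_mul, mul_comm Complex.I, Complex.exp_ofReal_mul_I_re, hcos,
    InnerProductGeometry.cos_angle]
  rcases eq_or_ne u 0 with rfl | hu
  · simp
  rcases eq_or_ne y 0 with rfl | hy
  · simp
  have hu' := norm_ne_zero_iff.2 hu
  have hy' := norm_ne_zero_iff.2 hy
  field_simp

theorem le_re_of_mem_SSG {H : L2 n → L2 n} {ε : ℝ}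
    (hp : ∀ u : L2 n, ε * ‖u‖ ^ 2 ≤ inner ℝ u (H u)) {z : ℂ} (hz : z ∈ SSG H) : ε ≤ z.re := by
  obtain ⟨u, hu, hz⟩ := hz
  have hu' := norm_pos_iff.2 hu
  rw [re_of_mem_gainPhasePoints hz, le_div_iff₀ (by positivity)]
  exact hp u

theorem inner_negScale_nonpos {H : L2 n → L2 n} (hp : ∀ u : L2 n, 0 ≤ inner ℝ u (H u)) {τ : ℝ}
    (hτ : 0 ≤ τ) (u : L2 n) : inner ℝ u (negScale τ H u) ≤ 0 := by
  rw [negScale, inner_smul_right]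
  exact mul_nonpos_of_nonpos_of_nonneg (neg_nonpos.2 hτ) (hp u)

theorem re_nonpos_of_mem_SSGinv_negScale {H : L2 n → L2 n}
    (hp : ∀ u : L2 n, 0 ≤ inner ℝ u (H u)) {τ : ℝ} (hτ : 0 ≤ τ) {z : ℂ}
    (hz : z ∈ SSGinv (negScale τ H)) : z.re ≤ 0 := by
  obtain ⟨u, -, hz⟩ := hz
  rw [re_of_mem_gainPhasePoints hz, real_inner_comm]
  exact div_nonpos_of_nonpos_of_nonneg (inner_negScale_nonpos hp hτ u) (by positivity)

theorem re_nonpos_of_mem_SSG_negScale {H : L2 n → L2 n}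
    (hp : ∀ u : L2 n, 0 ≤ inner ℝ u (H u)) {τ : ℝ} (hτ : 0 ≤ τ) {z : ℂ}
    (hz : z ∈ SSG (negScale τ H)) : z.re ≤ 0 := by
  obtain ⟨u, -, hz⟩ := hz
  rw [re_of_mem_gainPhasePoints hz]
  exact div_nonpos_of_nonpos_of_nonneg (inner_negScale_nonpos hp hτ u) (by positivity)

/-- The inverse graph divides by `‖H u‖²`, which the gain bound compares with `‖u‖²`; hence the
factor `1 / c ^ 2`. -/
theorem le_re_of_mem_SSGinv {H : L2 n → L2 n} {ε c : ℝ} (hε : 0 < ε) (hc : 0 < c)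
    (hp : ∀ u : L2 n, ε * ‖u‖ ^ 2 ≤ inner ℝ u (H u)) (hb : ∀ u, ‖H u‖ ≤ c * ‖u‖) {z : ℂ}
    (hz : z ∈ SSGinv H) : ε / c ^ 2 ≤ z.re := by
  obtain ⟨u, hu, hz⟩ := hz
  have hu' := norm_pos_iff.2 hu
  rw [re_of_mem_gainPhasePoints hz, real_inner_comm, div_le_div_iff₀ (by positivity) (by positivity)]
  calc ε * ‖H u‖ ^ 2 ≤ ε * (c * ‖u‖) ^ 2 := by gcongr; exact hb u
    _ = ε * ‖u‖ ^ 2 * c ^ 2 := by ring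
    _ ≤ inner ℝ u (H u) * c ^ 2 := by gcongr; exact hp u

theorem ofReal_le_setDist_of_re {A B : Set ℂ} {r : ℝ} (hA : ∀ a ∈ A, r ≤ a.re)
    (hB : ∀ b ∈ B, b.re ≤ 0) : ENNReal.ofReal r ≤ setDist A B := by
  refine le_iInf₂ fun a ha => le_iInf₂ fun b hb => ?_
  rw [edist_dist]
  apply ENNReal.ofReal_le_ofReal
  rw [Complex.dist_eq]
  have h := Complex.re_le_norm (a - b)
  rw [Complex.sub_re] at h
  linarith [hA a ha, hB b hb]

/-! ### Exceptional inputs -/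

theorem hilbertPairing_zero_right (u : L2 n) : hilbertPairing u 0 = 0 := by
  refine integral_eq_zero_of_ae ?_
  have h := Lp.coeFn_zero (EuclideanSpace ℝ (Fin n)) 2 timeMeasure
  rw [timeMeasure, EventuallyEq, ae_restrict_iff' measurableSet_Ici] at h
  filter_upwards [h] with t ht
  have h0 : embed (0 : L2 n) t = 0 := by
    by_cases h' : t ∈ Ici (0 : ℝ)
    · exact (indicator_of_mem h' _).trans (ht h')
    · exact indicator_of_notMem h' _
  simp [h0]

theorem exceptionalInputs_eq_empty {H₁ H₂ : L2 n → L2 n} (h₁ : IsInputStrictlyPassive H₁)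
    (h₂ : IsPassive H₂) : exceptionalInputs H₁ H₂ = ∅ := by
  rw [eq_empty_iff_forall_notMem]
  rintro w ⟨τ, hτ, u₁, _, _, rfl, rfl, -, hi, -, hneg⟩
  obtain ⟨hb₁, ε, hε, hp₁⟩ := h₁
  have e₁ := hp₁ u₁
  have e₂ : 0 ≤ inner ℝ (H₁ u₁) (τ • H₂ (H₁ u₁)) := by
    rw [inner_smul_right]
    exact mul_nonneg hτ.1.le (h₂.2 _)
  -- The two pairings sum to zero and the second is nonnegative, so `ε‖u₁‖² ≤ 0`.
  have hu : u₁ = 0 := by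
    by_contra hne
    have := norm_pos_iff.2 hne
    have : 0 < ε * ‖u₁‖ ^ 2 := by positivity
    linarith
  rw [hu, hb₁.map_zero, hilbertPairing_zero_right, zero_mul] at hneg
  exact hneg.false

end PassivityFeedback

theorem mainTheorem3 (n : ℕ)
    (H₁ H₂ : PassivityFeedback.L2 n → PassivityFeedback.L2 n)
    (hc₁ : PassivityFeedback.IsCausal H₁) (hc₂ : PassivityFeedback.IsCausal H₂)
    (hwp : PassivityFeedback.WellPosed H₁ H₂)
    (h₁ : PassivityFeedback.IsInputStrictlyPassive H₁)
    (h₂ : PassivityFeedback.IsPassive H₂) :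
    PassivityFeedback.FeedbackFiniteGainStable H₁ H₂ ∧
    (∃ ε : ℝ, 0 < ε ∧ PassivityFeedback.SSG H₁ ⊆ {z : ℂ | ε ≤ z.re} ∧
      ∀ τ ∈ Set.Ioc (0 : ℝ) 1,
        PassivityFeedback.SSGinv (PassivityFeedback.negScale τ H₂) ⊆ {z : ℂ | z.re ≤ 0}) ∧
    (∃ r : ℝ, 0 < r ∧ ∀ τ ∈ Set.Ioc (0 : ℝ) 1,
      ENNReal.ofReal r ≤ PassivityFeedback.setDist (PassivityFeedback.SSGinv H₁)
        (PassivityFeedback.SSG (PassivityFeedback.negScale τ H₂))) ∧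
    PassivityFeedback.exceptionalInputs H₁ H₂ = ∅ := by
  refine ⟨PassivityFeedback.feedbackFiniteGainStable_of_passive hwp h₁ h₂, ?_, ?_,
    PassivityFeedback.exceptionalInputs_eq_empty h₁ h₂⟩
  · obtain ⟨-, ε, hε, hp₁⟩ := h₁
    exact ⟨ε, hε, fun z hz => PassivityFeedback.le_re_of_mem_SSG hp₁ hz,
      fun τ hτ z hz => PassivityFeedback.re_nonpos_of_mem_SSGinv_negScale h₂.2 hτ.1.le hz⟩
  · obtain ⟨hb₁, ε, hε, hp₁⟩ := h₁
    obtain ⟨c, hc, hb₁⟩ := hb₁.exists_pos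
    exact ⟨ε / c ^ 2, by positivity, fun τ hτ => PassivityFeedback.ofReal_le_setDist_of_re
      (fun a ha => PassivityFeedback.le_re_of_mem_SSGinv hε hc hp₁ hb₁ ha)
      (fun b hb => PassivityFeedback.re_nonpos_of_mem_SSG_negScale h₂.2 hτ.1.le hb)⟩
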